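/- **Calculus.** Let $\mathit{Name}_v$ be a set of visible action names, $\tau\notin\mathit{Name}_v$, $\mathit{Name}=\mathit{Name}_v\cup\{\tau\}$. Rates $\tilde\lambda$ are either $\lambda\in\mathbb R_{>0}$ (exponentially timed) or passive, $*_w$ with $w\in\mathbb R_{>0}$. Terms are $$P::=\underline 0\mid\langle a,\lambda\rangle.P\mid\langle a,*_w\rangle.P\mid P+P\mid P\parallel_S P\mid P/H\mid P[\varphi]\mid X\mid \mathrm{rec}\,X:P$$ with $S,H\subseteq\mathit{Name}_v$, $\varphi:\mathit{Name}\to\mathit{Name}$ with $\varphi^{-1}(\tau)=\{\tau\}$, and process variables $X$. The process terms are the closed and guarded terms. Their transitions $P\xrightarrow{a,\tilde\lambda}P'$ form a multiset (the multiplicity being the number of derivations) given by the usual rules: a prefix performs its action; a sum, hiding ($a\in H$ becomes $\tau$), relabeling and recursion (by unfolding) move as usual; $P_1\parallel_S P_2$ moves asynchronously on names outside $S$, and on a name $a\in S$ it synchronizes $\lambda$ with $*_w$ at rate $\lambda\cdot w/\mathrm{weight}(a)$, where $\mathrm{weight}(a)$ is the sum of the weights of all passive $a$-transitions of the passive partner,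 and $*_{w_1}$ with $*_{w_2}$ at $*_{\frac{w_1}{W_1}\frac{w_2}{W_2}(W_1+W_2)}$, with $W_i=\mathrm{weight}(P_i,a)$; two exponentially timed actions do not synchronize. A process term is *performance closed* if no state reachable from it has a passive transition. For $A\subseteq\mathit{Name}$, $\mathrm{rate}_o(P,A)$ is the sum of the rates of the exponentially timed transitions of $P$ with name in $A$ (with multiplicity), and $\mathrm{rate}_t(P)=\mathrm{rate}_o(P,\mathit{Name})$. **Computations.** For a finite computation $c$ of a performance closed term, $\mathrm{prob}(c)$ is the product over its steps $Q\xrightarrow{a,\lambda}Q'$ of $\lambda/\mathrm{rate}_t(Q)$, and its stepwise average duration is the sequence of the numbers $1/\mathrm{rate}_t(Q)$ for the source states $Q$ of its steps. **Testing equivalence.** Reactive tests are $T::=\mathrm s\mid T'$, $T'::=\langle a,*_w\rangle.T\mid T'+T'$ with $a\in\mathit{Name}_v$, $w>0$, where the constant $\mathrm s$ (success) has no transitions. For $\theta\in(\mathbb R_{>0})^*$ let $\mathcal{SC}^{|\theta|}_{\le\theta}(P,T)$ be the multiset of the computations of $P\parallel_{\mathit{Name}_v}T$ of length $|\theta|$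 that traverse a state whose test component is $\mathrm s$ and whose stepwise average duration is componentwise at most $\theta$; $\mathrm{prob}$ of it is the sum of the probabilities of its elements. Performance closed $P_1,P_2$ are *Markovian testing equivalent*, $P_1\sim_{MT}P_2$, iff $\mathrm{prob}(\mathcal{SC}^{|\theta|}_{\le\theta}(P_1,T))=\mathrm{prob}(\mathcal{SC}^{|\theta|}_{\le\theta}(P_2,T))$ for all reactive tests $T$ and all $\theta\in(\mathbb R_{>0})^*$. **Modal language.** $\mathcal{ML}_{MT}$ is given by $\phi::=\mathrm{true}\mid\phi'$, $\phi'::=\langle a\rangle\phi\mid\phi'\lor\phi'$ with $a\in\mathit{Name}_v$, where every $\phi_1\lor\phi_2$ satisfies $\mathrm{init}(\phi_1)\cap\mathrm{init}(\phi_2)=\emptyset$; here $\mathrm{init}(\mathrm{true})=\emptyset$, $\mathrm{init}(\langle a\rangle\phi)=\{a\}$, $\mathrm{init}(\phi_1\lor\phi_2)=\mathrm{init}(\phi_1)\cup\mathrm{init}(\phi_2)$. **Interpretation.** $[\![\phi]\!](P,\varepsilon)$ is $1$ if $\phi=\mathrm{true}$ and $0$ otherwise. For a sequence $t\circ\theta$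 put $R=\mathrm{rate}_o(P,\mathrm{init}(\phi)\cup\{\tau\})$. If $R=0$, then $[\![\phi]\!](P,t\circ\theta)=0$. Otherwise, with sums over exponentially timed transitions counted with multiplicity: - $[\![\mathrm{true}]\!](P,t\circ\theta)=\sum_{P\xrightarrow{\tau,\lambda}P'}\frac\lambda R[\![\mathrm{true}]\!](P',\theta)$ if $1/R\le t$, and $0$ if $1/R>t$; - $[\![\langle a\rangle\phi]\!](P,t\circ\theta)=\sum_{P\xrightarrow{a,\lambda}P'}\frac\lambda R[\![\phi]\!](P',\theta)+\sum_{P\xrightarrow{\tau,\lambda}P'}\frac\lambda R[\![\langle a\rangle\phi]\!](P',\theta)$ if $1/R\le t$, and $0$ if $1/R>t$; - $[\![\phi_1\lor\phi_2]\!](P,t\circ\theta)=\sum_{j=1,2}p_j\,[\![\phi_j]\!](P_{\text{no-init-}\tau},t_j\circ\theta)+\Sigma_\tau$, where $p_j=R_j/R$ and $t_j=t+(1/R_j-1/R)$ with $R_j=\mathrm{rate}_o(P,\mathrm{init}(\phi_j))$ (the $j$-th summand being $0$ if $R_j=0$), $P_{\text{no-init-}\tau}$ is $P$ devoid of its initial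 $\tau$-transitions, i.e. the sum of the terms $\langle a,\tilde\lambda\rangle.P'$ over all transitions $P\xrightarrow{a,\tilde\lambda}P'$ with $a\ne\tau$ ($\underline 0$ if there are none), and $\Sigma_\tau=\sum_{P\xrightarrow{\tau,\lambda}P'}\frac\lambda R[\![\phi_1\lor\phi_2]\!](P',\theta)$ if $1/R\le t$, and $\Sigma_\tau=0$ if $1/R>t$. **Theorem.** For all performance closed process terms $P_1,P_2$: $P_1\sim_{MT}P_2$ if and only if $[\![\phi]\!](P_1,\theta)=[\![\phi]\!](P_2,\theta)$ for every $\phi\in\mathcal{ML}_{MT}$ and every $\theta\in(\mathbb R_{>0})^*$. -/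

import Mathlib

noncomputable section

namespace MPC

/-- Action names over the type `ν` of visible names: the internal name `τ` or a visible one. -/
inductive ActName (ν : Type*) where
  | tau : ActName ν
  | vis : ν → ActName ν

/-- Action rates: `exp r` is the rate `r` of an exponentially timed action, `pas w` is the passive
rate `*_w`. Positivity of `r` and `w` is required of process terms by `Proc.RatesPos`. -/
inductive Rate where
  | exp : ℝ → Rate
  | pas : ℝ → Rate

/-- The real number carried by a rate is positive. -/
def Rate.Pos : Rate → Prop
  | .exp r => 0 < r
  | .pas w => 0 < w

/-- Actions: a name together with a rate. -/
abbrev Act (ν : Type*) := ActName ν × Rate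

/-- Relabeling functions: they preserve visibility, i.e. the preimage of `τ` is `{τ}`. -/
abbrev Relabeling (ν : Type*) :=
  {f : ActName ν → ActName ν // f ⁻¹' {ActName.tau} = {ActName.tau}}

/-- Terms of the Markovian process calculus over visible names `ν` and variables `V`, extended with
the success constant `s` (`success`), which is used in tests only. The synchronization set of
`par` and the set of `hide` are sets of visible names. `recur X P` is `rec X : P`. -/
inductive Proc (ν : Type*) (V : Type*) where
  | nil : Proc ν V
  | success : Proc ν V
  | pre : Act ν → Proc ν V → Proc ν V
  | alt : Proc ν V → Proc ν V → Proc ν V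
  | par : Proc ν V → Set ν → Proc ν V → Proc ν V
  | hide : Proc ν V → Set ν → Proc ν V
  | relabel : Proc ν V → Relabeling ν → Proc ν V
  | var : V → Proc ν V
  | recur : V → Proc ν V → Proc ν V

namespace Proc

variable {ν : Type*} {V : Type*}

/-! ### Static notions -/

/-- All rates and weights in the term are positive. -/
def RatesPos : Proc ν V → Prop
  | nil => True
  | success => True
  | pre α P => α.2.Pos ∧ P.RatesPos
  | alt P Q => P.RatesPos ∧ Q.RatesPos
  | par P _ Q => P.RatesPos ∧ Q.RatesPos
  | hide P _ => P.RatesPos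
  | relabel P _ => P.RatesPos
  | var _ => True
  | recur _ P => P.RatesPos

/-- The success constant does not occur in the term. -/
def NoSuccess : Proc ν V → Prop
  | nil => True
  | success => False
  | pre _ P => P.NoSuccess
  | alt P Q => P.NoSuccess ∧ Q.NoSuccess
  | par P _ Q => P.NoSuccess ∧ Q.NoSuccess
  | hide P _ => P.NoSuccess
  | relabel P _ => P.NoSuccess
  | var _ => True
  | recur _ P => P.NoSuccess

/-- Free process variables. -/
def freeVars : Proc ν V → Set V
  | nil => ∅
  | success => ∅
  | pre _ P => P.freeVars
  | alt P Q => P.freeVars ∪ Q.freeVars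
  | par P _ Q => P.freeVars ∪ Q.freeVars
  | hide P _ => P.freeVars
  | relabel P _ => P.freeVars
  | var X => {X}
  | recur X P => P.freeVars \ {X}

/-- Process variables with a free occurrence that is not inside any action prefix. -/
def unguardedVars : Proc ν V → Set V
  | nil => ∅
  | success => ∅
  | pre _ _ => ∅
  | alt P Q => P.unguardedVars ∪ Q.unguardedVars
  | par P _ Q => P.unguardedVars ∪ Q.unguardedVars
  | hide P _ => P.unguardedVars
  | relabel P _ => P.unguardedVars
  | var X => {X}
  | recur X P => P.unguardedVars \ {X}

/-- In every subterm `rec X : Q`, all the free occurrences of `X` in `Q` are inside a prefix. -/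
def Guarded : Proc ν V → Prop
  | nil => True
  | success => True
  | pre _ P => P.Guarded
  | alt P Q => P.Guarded ∧ Q.Guarded
  | par P _ Q => P.Guarded ∧ Q.Guarded
  | hide P _ => P.Guarded
  | relabel P _ => P.Guarded
  | var _ => True
  | recur X P => X ∉ P.unguardedVars ∧ P.Guarded

/-- The closed and guarded process terms of the calculus (without the success constant). -/
structure IsProc (P : Proc ν V) : Prop where
  ratesPos : P.RatesPos
  noSuccess : P.NoSuccess
  closed : P.freeVars = ∅
  guarded : P.Guarded

open Classical in
/-- Syntactical replacement of the free occurrences of `X` by `R`. It is used with closed `R` only,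
so no variable can be captured. -/
def subst (X : V) (R : Proc ν V) : Proc ν V → Proc ν V
  | nil => nil
  | success => success
  | pre α P => pre α (subst X R P)
  | alt P Q => alt (subst X R P) (subst X R Q)
  | par P S Q => par (subst X R P) S (subst X R Q)
  | hide P H => hide (subst X R P) H
  | relabel P f => relabel (subst X R P) f
  | var Y => if Y = X then R else var Y
  | recur Y P => if Y = X then recur Y P else recur Y (subst X R P)

/-- Number of operators outside all prefixes; termination measure of the operational semantics. -/
def unguardedSize : Proc ν V → ℕ
  | nil => 1
  | success => 1
  | pre _ _ => 1
  | alt P Q => P.unguardedSize + Q.unguardedSize + 1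
  | par P _ Q => P.unguardedSize + Q.unguardedSize + 1
  | hide P _ => P.unguardedSize + 1
  | relabel P _ => P.unguardedSize + 1
  | var _ => 1
  | recur _ P => P.unguardedSize + 1

theorem unguardedSize_subst (X : V) (R P : Proc ν V) (h : X ∉ P.unguardedVars) :
    (subst X R P).unguardedSize = P.unguardedSize := by
  induction P with
  | nil => rfl
  | success => rfl
  | pre α P ih => rfl
  | alt P Q ihP ihQ =>
    simp only [unguardedVars, Set.mem_union, not_or] at h
    simp [subst, unguardedSize, ihP h.1, ihQ h.2]
  | par P S Q ihP ihQ =>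
    simp only [unguardedVars, Set.mem_union, not_or] at h
    simp [subst, unguardedSize, ihP h.1, ihQ h.2]
  | hide P H ih => simp [subst, unguardedSize, ih h]
  | relabel P f ih => simp [subst, unguardedSize, ih h]
  | var Y =>
    have hne : ¬ Y = X := fun e => h (by simp [unguardedVars, e])
    simp [subst, hne]
  | recur Y P ih =>
    by_cases e : Y = X
    · simp [subst, e]
    · have hP : X ∉ P.unguardedVars := fun hX =>
        h ⟨hX, fun e' => e (Set.mem_singleton_iff.mp e').symm⟩
      simp [subst, e, unguardedSize, ih hP]

/-! ### Operational semantics -/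

open Classical in
/-- `weight(P, a)`, computed from the multiset `m` of transitions of `P`: the sum of the weights of
the passive transitions with name `a`. -/
def weightOf (m : Multiset (Act ν × Proc ν V)) (a : ActName ν) : ℝ :=
  (m.map fun x =>
    match x.1.2 with
    | .exp _ => 0
    | .pas w => if x.1.1 = a then w else 0).sum

/-- The rate of a synchronization on an action name for which `W₁` and `W₂` are the weights of the
two sides. Two exponentially timed actions cannot synchronize. -/
def syncRate (W₁ W₂ : ℝ) : Rate → Rate → Option Rate
  | .exp r, .pas w => some (.exp (r * (w / W₂)))
  | .pas w, .exp r => some (.exp (r * (w / W₁)))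
  | .pas w₁, .pas w₂ => some (.pas (w₁ / W₁ * (w₂ / W₂) * (W₁ + W₂)))
  | .exp _, .exp _ => none

open Classical in
/-- The transitions of `P ∥_S Q`, from the multisets `m` and `n` of transitions of `P` and `Q`:
the moves of `P` alone, the moves of `Q` alone, and the synchronizations on names in `S`. -/
def parTrans (P : Proc ν V) (S : Set ν) (Q : Proc ν V) (m n : Multiset (Act ν × Proc ν V)) :
    Multiset (Act ν × Proc ν V) :=
  (m.filter fun x => x.1.1 ∉ ActName.vis '' S).map (fun x => (x.1, par x.2 S Q))
  + (n.filter fun y => y.1.1 ∉ ActName.vis '' S).map (fun y => (y.1, par P S y.2))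
  + (m ×ˢ n).filterMap fun z =>
      if z.1.1.1 = z.2.1.1 ∧ z.1.1.1 ∈ ActName.vis '' S then
        (syncRate (weightOf m z.1.1.1) (weightOf n z.1.1.1) z.1.1.2 z.2.1.2).map
          fun r => ((z.1.1.1, r), par z.1.2 S z.2.2)
      else none

open Classical in
/-- The multiset of transitions `P --α--> P'` of a term, as pairs `(α, P')`; the multiplicity of a
transition is the number of its derivations. The term `rec X : P` moves as its unfolding; the value
for unguarded recursions is irrelevant, since they are not process terms. -/
def trans : Proc ν V → Multiset (Act ν × Proc ν V)
  | nil => 0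
  | success => 0
  | pre α P => {(α, P)}
  | alt P Q => trans P + trans Q
  | par P S Q => parTrans P S Q (trans P) (trans Q)
  | hide P H => (trans P).map fun x =>
      ((if x.1.1 ∈ ActName.vis '' H then ActName.tau else x.1.1, x.1.2), hide x.2 H)
  | relabel P f => (trans P).map fun x => ((f.1 x.1.1, x.1.2), relabel x.2 f)
  | var _ => 0
  | recur X P => if _h : X ∉ P.unguardedVars then trans (subst X (recur X P) P) else 0
termination_by P => P.unguardedSize
decreasing_by
  all_goals simp only [unguardedSize]
  all_goals first
    | omega
    | (rw [unguardedSize_subst X _ P _h]; omega)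

/-- `Q` is a state of the labeled multitransition system of `P`. -/
def Reachable (P Q : Proc ν V) : Prop :=
  Relation.ReflTransGen (fun P Q => ∃ α, (α, Q) ∈ trans P) P Q

/-- Performance closed process terms: no state has a passive transition. -/
structure PerfClosed (P : Proc ν V) : Prop where
  isProc : P.IsProc
  noPassive : ∀ Q, Reachable P Q → ∀ a w R, ((a, Rate.pas w), R) ∉ trans Q

open Classical in
/-- The multiset of the pairs `(r, P')` for the exponentially timed transitions `P --a,r--> P'`
with `a ∈ A`. -/
def expMoves (P : Proc ν V) (A : Set (ActName ν)) : Multiset (ℝ × Proc ν V) :=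
  (trans P).filterMap fun x =>
    match x.1.2 with
    | .exp r => if x.1.1 ∈ A then some (r, x.2) else none
    | .pas _ => none

/-- The overall exit rate at level `0` of `P` with respect to the names in `A`. -/
def rateO (P : Proc ν V) (A : Set (ActName ν)) : ℝ :=
  ((expMoves P A).map Prod.fst).sum

/-- The total exit rate of `P` at level `0`. -/
def rateT (P : Proc ν V) : ℝ := rateO P Set.univ

/-! ### Computations -/

/-- A finite-length computation of a given initial term, as the list of the actions performed and
the states reached by them. -/
abbrev Comp (ν : Type*) (V : Type*) := List (Act ν × Proc ν V)

/-- The multiset of the computations of `P` of length `n`. -/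
def comps : ℕ → Proc ν V → Multiset (Comp ν V)
  | 0, _ => {[]}
  | n + 1, P => (trans P).bind fun x => (comps n x.2).map fun c => x :: c

/-- Execution probability of a computation of `P`. Computations of performance closed terms have no
passive transitions, so the value for these is irrelevant. -/
def prob : Proc ν V → Comp ν V → ℝ
  | _, [] => 1
  | P, ((_, .exp r), P') :: c => r / rateT P * prob P' c
  | _, ((_, .pas _), _) :: _ => 0

/-- Stepwise average duration of a computation of `P`. -/
def avgTime : Proc ν V → Comp ν V → List ℝ
  | _, [] => []
  | P, x :: c => 1 / rateT P :: avgTime x.2 c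

/-- The stepwise average duration of the computation `c` of `P` is not greater than `θ`. -/
def Within (P : Proc ν V) (c : Comp ν V) (θ : List ℝ) : Prop :=
  c.length ≤ θ.length ∧
    ∀ (i : ℕ) (d t : ℝ), (avgTime P c)[i]? = some d → θ[i]? = some t → d ≤ t

/-! ### Tests and Markovian testing equivalence -/

/-- Second level of the syntax of reactive tests: `T' ::= ⟨a, *_w⟩.T | T' + T'` with `a` visible
and `w > 0`, where `T ::= s | T'`. -/
def IsTestSum : Proc ν V → Prop
  | pre (.vis _, .pas w) T => 0 < w ∧ (T = success ∨ T.IsTestSum)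
  | alt T₁ T₂ => T₁.IsTestSum ∧ T₂.IsTestSum
  | _ => False

/-- Reactive tests: `T ::= s | T'`. -/
def IsTest (T : Proc ν V) : Prop := T = success ∨ T.IsTestSum

/-- The interaction system: synchronization on all visible names. -/
def interaction (P T : Proc ν V) : Proc ν V := par P Set.univ T

/-- A configuration is successful if its test projection is `s`. -/
def SuccessfulConfig (C : Proc ν V) : Prop := ∃ P', C = par P' Set.univ success

/-- The computation `c` of `C` traverses a successful configuration. -/
def SuccessfulComp (C : Proc ν V) (c : Comp ν V) : Prop :=
  ∃ C' ∈ C :: c.map Prod.snd, SuccessfulConfig C'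

open Classical in
/-- The multiset of the successful computations of the interaction system of `P` and `T` that have
length `|θ|` and stepwise average duration not greater than `θ`. -/
def successComps (P T : Proc ν V) (θ : List ℝ) : Multiset (Comp ν V) :=
  (comps θ.length (interaction P T)).filter fun c =>
    SuccessfulComp (interaction P T) c ∧ Within (interaction P T) c θ

/-- The probability of executing a computation in `successComps P T θ`. -/
def passProb (P T : Proc ν V) (θ : List ℝ) : ℝ :=
  ((successComps P T θ).map (prob (interaction P T))).sum

/-- Markovian testing equivalence. -/
def MTEquiv (P₁ P₂ : Proc ν V) : Prop :=
  ∀ T : Proc ν V, IsTest T → ∀ θ : List ℝ, (∀ t ∈ θ, 0 < t) →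
    passProb P₁ T θ = passProb P₂ T θ

/-- `P` devoid of its computations starting with a `τ`-transition: the sum of all `α.P'` for the
transitions `P --α--> P'` whose name is not `τ`, which is `nil` if there are none. -/
def noInitTau (P : Proc ν V) : Proc ν V := by
  classical
  exact (((trans P).filter fun x => x.1.1 ≠ ActName.tau).toList.map
    fun x => pre x.1 x.2).foldr alt nil

end Proc

/-! ### The modal language -/

/-- Raw formulas: true, diamond, disjunction. -/
inductive Formula (ν : Type*) where
  | tt : Formula ν
  | dia : ν → Formula ν → Formula ν
  | disj : Formula ν → Formula ν → Formula ν

namespace Formula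

variable {ν : Type*} {V : Type*}

/-- The set of initial (visible) names of a formula. -/
def init : Formula ν → Set (ActName ν)
  | tt => ∅
  | dia a _ => {ActName.vis a}
  | disj φ₁ φ₂ => φ₁.init ∪ φ₂.init

/-- Second level of the syntax: `φ' ::= ⟨a⟩φ | φ' ∨ φ'` with disjoint initial sets in each
disjunction, where `φ ::= true | φ'`. -/
def IsProper : Formula ν → Prop
  | tt => False
  | dia _ φ => φ = tt ∨ φ.IsProper
  | disj φ₁ φ₂ => φ₁.IsProper ∧ φ₂.IsProper ∧ φ₁.init ∩ φ₂.init = ∅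

/-- The formulas of the modal language: `φ ::= true | φ'`. -/
def InML (φ : Formula ν) : Prop := φ = tt ∨ φ.IsProper

open Classical Proc in
/-- The quantitative interpretation of a formula at a process term and a sequence of average time
bounds. In the clause for disjunction, if the rate `Rⱼ` is zero then so is the weight `Rⱼ / R` of
the `j`-th disjunct, and its time bound is irrelevant. -/
def eval : Formula ν → Proc ν V → List ℝ → ℝ
  | tt, _, [] => 1
  | dia _ _, _, [] => 0
  | disj _ _, _, [] => 0
  | tt, P, t :: θ =>
      let R := rateO P {ActName.tau}
      if R = 0 then 0
      else if 1 / R ≤ t then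
        ((expMoves P {ActName.tau}).map fun x => x.1 / R * eval tt x.2 θ).sum
      else 0
  | dia a φ, P, t :: θ =>
      let R := rateO P ({ActName.vis a} ∪ {ActName.tau})
      if R = 0 then 0
      else if 1 / R ≤ t then
        ((expMoves P {ActName.vis a}).map fun x => x.1 / R * eval φ x.2 θ).sum
        + ((expMoves P {ActName.tau}).map fun x => x.1 / R * eval (dia a φ) x.2 θ).sum
      else 0
  | disj φ₁ φ₂, P, t :: θ =>
      let R := rateO P ((disj φ₁ φ₂).init ∪ {ActName.tau})
      let R₁ := rateO P φ₁.init
      let R₂ := rateO P φ₂.init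
      if R = 0 then 0
      else
        R₁ / R * eval φ₁ (noInitTau P) ((t + (1 / R₁ - 1 / R)) :: θ)
        + R₂ / R * eval φ₂ (noInitTau P) ((t + (1 / R₂ - 1 / R)) :: θ)
        + (if 1 / R ≤ t then
            ((expMoves P {ActName.tau}).map fun x => x.1 / R * eval (disj φ₁ φ₂) x.2 θ).sum
          else 0)
termination_by φ _ θ => (θ.length, sizeOf φ)

end Formula

end MPC

end

namespace MPC

open ActName

namespace Proc

variable {ν : Type*} {V : Type*}

/-! ### Positivity of rates along transitions -/

/-! Tests and formulas are both read as functionals of a term and a sequence of bounds, and apart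
from success and `tt` both obey one recursion, `step A g`: internal moves are made until a name `a`
in `A` occurs, then `g a` takes over. For a test (`passProb_eq_step`), `A` consists of the offered
names and `g a` averages the success probabilities after the `a`-branches, each weighted by its
share of the total weight. For a formula (`eval_dia`, `eval_disj`), `A` consists of the initial
names and `g a` evaluates the subformula behind `a`.

Hence a formula is a test in which no choice offers the same name twice (`InML.exists_isTest`),
which gives one implication. A test with several `a`-branches need not be of this form, but `step A`
is linear in the family `g`, so the averages can be pulled out of all levels of the test: its
functional is a convex combination of functionals of formulas (`IsTest.indicator_passProb_mem`). For
fixed bounds, the functionals that agree at the two given terms form a convex set, so agreement on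
formulas extends to tests.

All comparisons are made on `Timed` terms, a class closed under transitions and under removal of
initial `τ`-moves. Cutting functionals to zero elsewhere by an indicator turns the comparisons into
equalities of functions, to which convex hulls apply. -/

theorem RatesPos.subst {X : V} {R : Proc ν V} (hR : R.RatesPos) {P : Proc ν V}
    (hP : P.RatesPos) : (subst X R P).RatesPos := by
  induction P with
  | nil => trivial
  | success => trivial
  | pre α P ih => exact ⟨hP.1, ih hP.2⟩
  | alt P Q ihP ihQ => exact ⟨ihP hP.1, ihQ hP.2⟩
  | par P S Q ihP ihQ => exact ⟨ihP hP.1, ihQ hP.2⟩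
  | hide P H ih => exact ih hP
  | relabel P f ih => exact ih hP
  | var Y =>
    by_cases e : Y = X
    · simpa [Proc.subst, e] using hR
    · simp [Proc.subst, e, RatesPos]
  | recur Y P ih =>
    by_cases e : Y = X
    · simpa [Proc.subst, e] using hP
    · simpa [Proc.subst, e, RatesPos] using ih hP

/-- The contribution of a transition to the weight of a passive name. -/
def passiveWeight : Rate → ℝ
  | .exp _ => 0
  | .pas w => w

open Classical in
theorem weightOf_eq (m : Multiset (Act ν × Proc ν V)) (a : ActName ν) :
    weightOf m a = (m.map fun x => if x.1.1 = a then passiveWeight x.1.2 else 0).sum := by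
  unfold weightOf
  congr 1
  refine Multiset.map_congr rfl fun x _ => ?_
  rcases x with ⟨⟨b, r | w⟩, P⟩ <;> simp [passiveWeight]

theorem passiveWeight_nonneg {r : Rate} (h : r.Pos) : 0 ≤ passiveWeight r := by
  cases r with
  | exp r => exact le_rfl
  | pas w => exact le_of_lt h

theorem weightOf_pos {m : Multiset (Act ν × Proc ν V)} (hm : ∀ x ∈ m, x.1.2.Pos)
    {a : ActName ν} {w : ℝ} {P : Proc ν V} (hx : ((a, Rate.pas w), P) ∈ m) :
    0 < weightOf m a := by
  classical
  rw [weightOf_eq]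
  have h0 : 0 < w := hm _ hx
  refine lt_of_lt_of_le h0 (Multiset.single_le_sum ?_ w ?_)
  · intro y hy
    obtain ⟨x, hx, rfl⟩ := Multiset.mem_map.mp hy
    split_ifs
    · exact passiveWeight_nonneg (hm x hx)
    · exact le_rfl
  · exact Multiset.mem_map.mpr ⟨_, hx, by simp [passiveWeight]⟩

/-- Each weight that occurs as a denominator is positive because the synchronizing passive
transition itself contributes to it. -/
theorem syncRate_pos {m n : Multiset (Act ν × Proc ν V)} (hm : ∀ x ∈ m, x.1.2.Pos)
    (hn : ∀ x ∈ n, x.1.2.Pos) {a : ActName ν} {r s t : Rate} {P Q : Proc ν V}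
    (hP : ((a, r), P) ∈ m) (hQ : ((a, s), Q) ∈ n)
    (h : syncRate (weightOf m a) (weightOf n a) r s = some t) : t.Pos := by
  have hr := hm _ hP
  have hs := hn _ hQ
  rcases r with r | r <;> rcases s with s | s <;> simp only [syncRate, Option.some.injEq,
    reduceCtorEq] at h <;> subst h <;> simp only [Rate.Pos] at hr hs ⊢
  · have := weightOf_pos hn hQ
    positivity
  · have := weightOf_pos hm hP
    positivity
  · have := weightOf_pos hn hQ
    have := weightOf_pos hm hP
    positivity

open Classical in
theorem RatesPos.of_mem_trans {P : Proc ν V} (h : P.RatesPos) :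
    ∀ x ∈ trans P, x.1.2.Pos ∧ x.2.RatesPos := by
  -- Structural induction would fail at `recur`, whose unfolding is not a subterm; the recursion of
  -- `trans` is followed instead.
  induction P using trans.induct with
  | case1 => simp [trans]
  | case2 => simp [trans]
  | case3 α P => simpa [trans, RatesPos] using h
  | case4 P Q ihP ihQ =>
    intro x hx
    rw [trans, Multiset.mem_add] at hx
    exact hx.elim (ihP h.1 x) (ihQ h.2 x)
  | case5 P S Q ihP ihQ =>
    intro x hx
    rw [trans, parTrans, Multiset.mem_add, Multiset.mem_add] at hx
    rcases hx with (hx | hx) | hx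
    · obtain ⟨y, hy, rfl⟩ := Multiset.mem_map.mp hx
      have := ihP h.1 y (Multiset.mem_filter.mp hy).1
      exact ⟨this.1, this.2, h.2⟩
    · obtain ⟨y, hy, rfl⟩ := Multiset.mem_map.mp hx
      have := ihQ h.2 y (Multiset.mem_filter.mp hy).1
      exact ⟨this.1, h.1, this.2⟩
    · obtain ⟨⟨⟨⟨a, r⟩, P'⟩, ⟨⟨b, s⟩, Q'⟩⟩, hz, hzx⟩ := Multiset.mem_filterMap _ _ |>.mp hx
      rw [Multiset.mem_product] at hz
      obtain ⟨hz1, hz2⟩ := hz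
      dsimp only at hzx hz1 hz2
      split_ifs at hzx with hab
      obtain ⟨rfl, hS⟩ := hab
      obtain ⟨t, ht, rfl⟩ := Option.map_eq_some_iff.mp hzx
      exact ⟨syncRate_pos (fun x hx => (ihP h.1 x hx).1) (fun x hx => (ihQ h.2 x hx).1) hz1 hz2 ht,
        (ihP h.1 _ hz1).2, (ihQ h.2 _ hz2).2⟩
  | case6 P H ih =>
    intro x hx
    rw [trans] at hx
    obtain ⟨y, hy, rfl⟩ := Multiset.mem_map.mp hx
    exact ih h y hy
  | case7 P f ih =>
    intro x hx
    rw [trans] at hx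
    obtain ⟨y, hy, rfl⟩ := Multiset.mem_map.mp hx
    exact ih h y hy
  | case8 X => simp [trans]
  | case9 X P hX ih =>
    intro x hx
    rw [trans, dif_pos hX] at hx
    exact ih (RatesPos.subst (X := X) (R := recur X P) h h) x hx
  | case10 X P hX => simp [trans, hX]

/-- All the transitions of all the states of `P` are exponentially timed with a positive rate. -/
def Timed (P : Proc ν V) : Prop :=
  ∀ Q, Reachable P Q → ∀ x ∈ trans Q, ∃ a r, 0 < r ∧ x.1 = (a, Rate.exp r)

/-- Only positivity of rates has to be carried along transitions. Closedness and guardedness of the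
reachable states play no role. -/
theorem PerfClosed.timed {P : Proc ν V} (h : P.PerfClosed) : P.Timed := by
  have hpos : ∀ Q, Reachable P Q → Q.RatesPos := by
    intro Q hQ
    induction hQ with
    | refl => exact h.isProc.ratesPos
    | tail _ hstep ih => obtain ⟨α, hα⟩ := hstep; exact (ih.of_mem_trans _ hα).2
  rintro Q hQ ⟨⟨a, r | w⟩, R⟩ hx
  · exact ⟨a, r, ((hpos Q hQ).of_mem_trans _ hx).1, rfl⟩
  · exact absurd hx (h.noPassive Q hQ a w R)

theorem Timed.of_mem_trans {P : Proc ν V} (h : P.Timed) {x : Act ν × Proc ν V}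
    (hx : x ∈ trans P) : x.2.Timed :=
  fun Q hQ => h Q (Relation.ReflTransGen.head ⟨x.1, hx⟩ hQ)

theorem Timed.exists_rate {P : Proc ν V} (h : P.Timed) {x : Act ν × Proc ν V}
    (hx : x ∈ trans P) : ∃ a r, 0 < r ∧ x.1 = (a, Rate.exp r) :=
  h P Relation.ReflTransGen.refl x hx

/-! ### Sums over exponentially timed moves -/

/-- The rate of an exponentially timed action, and `0` for passive ones. -/
def expRate : Rate → ℝ
  | .exp r => r
  | .pas _ => 0

open Classical in
-- Turns sums over different sets of names into sums over the single multiset `trans P`, where they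
-- can be compared term by term.
theorem sum_expMoves (P : Proc ν V) (A : Set (ActName ν)) (f : Proc ν V → ℝ) :
    ((expMoves P A).map fun x => x.1 * f x.2).sum =
      ((trans P).map fun x => if x.1.1 ∈ A then expRate x.1.2 * f x.2 else 0).sum := by
  unfold expMoves
  induction trans P using Multiset.induction_on with
  | empty => simp
  | cons x m ih =>
    rcases x with ⟨⟨a, r | w⟩, Q⟩
    · by_cases ha : a ∈ A
      · rw [Multiset.filterMap_cons_some (b := (r, Q)) (h := by simp [ha])]
        simp [ih, ha, expRate]
      · rw [Multiset.filterMap_cons_none (h := by simp [ha])]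
        simp [ih, ha]
    · rw [Multiset.filterMap_cons_none (h := rfl)]
      simp [ih, expRate]

open Classical in
theorem rateO_eq (P : Proc ν V) (A : Set (ActName ν)) :
    rateO P A = ((trans P).map fun x => if x.1.1 ∈ A then expRate x.1.2 else 0).sum := by
  simpa [rateO] using sum_expMoves P A fun _ => 1

theorem rateT_eq (P : Proc ν V) :
    rateT P = ((trans P).map fun x => expRate x.1.2).sum := by
  simp [rateT, rateO_eq]

theorem mem_expMoves {P : Proc ν V} {A : Set (ActName ν)} {x : ℝ × Proc ν V} :
    x ∈ expMoves P A ↔ ∃ a ∈ A, ((a, Rate.exp x.1), x.2) ∈ trans P := by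
  classical
  unfold expMoves
  rw [Multiset.mem_filterMap]
  constructor
  · rintro ⟨⟨⟨a, r | w⟩, Q⟩, hy, h⟩
    · by_cases ha : a ∈ A
      · simp only [ha, if_true, Option.some.injEq] at h
        subst h
        exact ⟨a, ha, hy⟩
      · simp [ha] at h
    · simp at h
  · rintro ⟨a, ha, h⟩
    exact ⟨_, h, by simp [ha]⟩

theorem Timed.of_mem_expMoves {P : Proc ν V} (h : P.Timed) {A : Set (ActName ν)}
    {x : ℝ × Proc ν V} (hx : x ∈ expMoves P A) : x.2.Timed := by
  obtain ⟨a, _, hx⟩ := mem_expMoves.mp hx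
  exact h.of_mem_trans hx

theorem Timed.pos_of_mem_expMoves {P : Proc ν V} (h : P.Timed) {A : Set (ActName ν)}
    {x : ℝ × Proc ν V} (hx : x ∈ expMoves P A) : 0 < x.1 := by
  obtain ⟨a, _, hx⟩ := mem_expMoves.mp hx
  obtain ⟨b, r, hr, he⟩ := h.exists_rate hx
  simp only [Prod.mk.injEq, Rate.exp.injEq] at he
  exact he.2 ▸ hr

/-! ### Removal of initial internal transitions -/

open Classical in
theorem trans_noInitTau (P : Proc ν V) :
    trans (noInitTau P) = (trans P).filter fun x => x.1.1 ≠ tau := by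
  have key : ∀ l : List (Act ν × Proc ν V),
      trans ((l.map fun x => pre x.1 x.2).foldr alt nil) = (l : Multiset (Act ν × Proc ν V)) := by
    intro l
    induction l with
    | nil => simp [trans]
    | cons x l ih => simp [trans, ih]
  unfold noInitTau
  rw [key, Multiset.coe_toList]

theorem Timed.noInitTau {P : Proc ν V} (h : P.Timed) : (noInitTau P).Timed := by
  classical
  have hsub : ∀ x ∈ trans (Proc.noInitTau P), x ∈ trans P := by
    intro x hx
    rw [trans_noInitTau] at hx
    exact (Multiset.mem_filter.mp hx).1
  intro Q hQ x hx
  rcases Relation.ReflTransGen.cases_head hQ with rfl | ⟨R, ⟨α, hα⟩, hR⟩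
  · exact h.exists_rate (hsub x hx)
  · exact h Q (Relation.ReflTransGen.head ⟨α, hsub _ hα⟩ hR) x hx

theorem expMoves_noInitTau (P : Proc ν V) {A : Set (ActName ν)} (hA : tau ∉ A) :
    expMoves (noInitTau P) A = expMoves P A := by
  classical
  unfold expMoves
  rw [trans_noInitTau]
  induction trans P using Multiset.induction_on with
  | empty => simp
  | cons x m ih =>
    rcases x with ⟨⟨a, r⟩, Q⟩
    by_cases ha : a = tau
    · subst ha
      rw [Multiset.filter_cons_of_neg _ (by simp), ih, Multiset.filterMap_cons_none]
      cases r <;> simp [hA]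
    · rw [Multiset.filter_cons_of_pos _ (by simpa using ha), Multiset.filterMap_cons,
        Multiset.filterMap_cons, ih]

theorem expMoves_noInitTau_tau (P : Proc ν V) : expMoves (noInitTau P) {tau} = 0 := by
  rw [Multiset.eq_zero_iff_forall_notMem]
  intro x hx
  obtain ⟨a, rfl, h⟩ := mem_expMoves.mp hx
  rw [trans_noInitTau] at h
  simp at h

theorem rateO_noInitTau (P : Proc ν V) {A : Set (ActName ν)} (hA : tau ∉ A) :
    rateO (noInitTau P) (A ∪ {tau}) = rateO P A := by
  classical
  rw [rateO_eq, rateO_eq, trans_noInitTau]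
  induction trans P using Multiset.induction_on with
  | empty => simp
  | cons x m ih =>
    by_cases hx : x.1.1 = tau
    · rw [Multiset.filter_cons_of_neg _ (by simpa using hx), ih]
      simp [hx, hA]
    · rw [Multiset.filter_cons_of_pos (p := fun x : Act ν × Proc ν V => x.1.1 ≠ tau) _ hx,
        Multiset.map_cons, Multiset.sum_cons, ih]
      simp [hx]

end Proc

end MPC

namespace MPC

open ActName

namespace Proc

variable {ν : Type*} {V : Type*}

/-! ### The stepwise semantics of a choice among visible names -/

/-- The value obtained by waiting for the first visible action of `P` with a name in `A`, and
continuing with the functional `g a` after the action `a`; every step, internal or not, has to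
comply with the bound on its average duration. -/
noncomputable def step (A : Finset ν) (g : ν → Proc ν V → List ℝ → ℝ) : Proc ν V → List ℝ → ℝ
  | _, [] => 0
  | P, t :: θ =>
      if 1 / rateO P (vis '' (A : Set ν) ∪ {tau}) ≤ t then
        ∑ a ∈ A, ((expMoves P {vis a}).map fun x =>
          x.1 / rateO P (vis '' (A : Set ν) ∪ {tau}) * g a x.2 θ).sum
        + ((expMoves P {tau}).map fun x =>
          x.1 / rateO P (vis '' (A : Set ν) ∪ {tau}) * step A g x.2 θ).sum
      else 0

theorem step_congr {A : Finset ν} {g g' : ν → Proc ν V → List ℝ → ℝ}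
    (h : ∀ a ∈ A, ∀ P : Proc ν V, P.Timed → ∀ θ, g a P θ = g' a P θ) {P : Proc ν V}
    (hP : P.Timed) (θ : List ℝ) : step A g P θ = step A g' P θ := by
  induction θ generalizing P with
  | nil => simp [step]
  | cons t θ ih =>
    simp only [step]
    congr 2
    · refine Finset.sum_congr rfl fun a ha => ?_
      congr 1
      refine Multiset.map_congr rfl fun x hx => ?_
      rw [h a ha x.2 (hP.of_mem_expMoves hx)]
    · congr 1
      refine Multiset.map_congr rfl fun x hx => ?_
      rw [ih (hP.of_mem_expMoves hx)]

theorem step_add (A : Finset ν) (g g' : ν → Proc ν V → List ℝ → ℝ) :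
    step A (g + g') = step A g + step A g' := by
  funext P θ
  induction θ generalizing P with
  | nil => simp [step]
  | cons t θ ih =>
    simp only [step, ih, Pi.add_apply, mul_add, Multiset.sum_map_add, Finset.sum_add_distrib]
    split_ifs <;> ring

theorem step_smul (A : Finset ν) (c : ℝ) (g : ν → Proc ν V → List ℝ → ℝ) :
    step A (c • g) = c • step A g := by
  funext P θ
  induction θ generalizing P with
  | nil => simp [step]
  | cons t θ ih =>
    simp only [step, ih, Pi.smul_apply, smul_eq_mul, mul_left_comm _ c, Multiset.sum_map_mul_left,
      ← Finset.mul_sum]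
    split_ifs <;> ring

/-! ### Computations -/

theorem within_cons {C : Proc ν V} {x : Act ν × Proc ν V} {c : Comp ν V} {t : ℝ} {θ : List ℝ} :
    Within C (x :: c) (t :: θ) ↔ 1 / rateT C ≤ t ∧ Within x.2 c θ := by
  constructor
  · rintro ⟨hl, h⟩
    exact ⟨h 0 _ _ rfl rfl, Nat.le_of_succ_le_succ hl, fun i d s hd hs => h (i + 1) d s hd hs⟩
  · rintro ⟨h0, hl, h⟩
    refine ⟨Nat.succ_le_succ hl, fun i d s hd hs => ?_⟩
    cases i with
    | zero =>
      simp only [avgTime, List.getElem?_cons_zero, Option.some.injEq] at hd hs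
      exact hd ▸ hs ▸ h0
    | succ i => exact h i d s hd hs

theorem prob_cons (C : Proc ν V) (x : Act ν × Proc ν V) (c : Comp ν V) :
    prob C (x :: c) = expRate x.1.2 / rateT C * prob x.2 c := by
  rcases x with ⟨⟨a, r | w⟩, Q⟩ <;> simp [prob, expRate]

open Classical in
/-- The probability of the successful computations of `C` within `θ`. -/
noncomputable def successProb (C : Proc ν V) (θ : List ℝ) : ℝ :=
  (((comps θ.length C).filter fun c => SuccessfulComp C c ∧ Within C c θ).map (prob C)).sum

theorem passProb_eq (P T : Proc ν V) (θ : List ℝ) :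
    passProb P T θ = successProb (interaction P T) θ := rfl

/-- First-step decomposition. The hypothesis `hC` says that the initial state may be ignored when
looking for a successful configuration, as long as at least one step is made. -/
theorem successProb_cons {C : Proc ν V}
    (hC : ∀ x ∈ trans C, ∀ c, SuccessfulComp C (x :: c) ↔ SuccessfulComp x.2 c)
    (t : ℝ) (θ : List ℝ) :
    successProb C (t :: θ) =
      if 1 / rateT C ≤ t then
        ((trans C).map fun x => expRate x.1.2 / rateT C * successProb x.2 θ).sum
      else 0 := by
  classical
  unfold successProb
  rw [List.length_cons, comps, Multiset.filter_bind, Multiset.map_bind, Multiset.sum_bind]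
  split_ifs with ht
  · congr 1
    refine Multiset.map_congr rfl fun x hx => ?_
    rw [Multiset.filter_map, Multiset.map_map, ← Multiset.sum_map_mul_left]
    congr 1
    have : ∀ c, (((fun c => SuccessfulComp C c ∧ Within C c (t :: θ)) ∘ fun c => x :: c) c) ↔
        (SuccessfulComp x.2 c ∧ Within x.2 c θ) := fun c => by
      simp only [Function.comp_apply, hC x hx c, within_cons, ht, true_and]
    rw [Multiset.filter_congr fun c _ => this c]
    exact Multiset.map_congr rfl fun c _ => prob_cons C x c
  · refine Multiset.sum_eq_zero fun y hy => ?_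
    obtain ⟨x, hx, rfl⟩ := Multiset.mem_map.mp hy
    rw [Multiset.filter_eq_nil.mpr]
    · simp
    · intro c hc h
      obtain ⟨c', _, rfl⟩ := Multiset.mem_map.mp hc
      exact ht (within_cons.mp h.2).1

/-! ### The interaction with a test -/

/-- All the initial transitions of `T` are passive with a visible name and a positive weight. -/
def Passive (T : Proc ν V) : Prop :=
  ∀ y ∈ trans T, ∃ a w, 0 < w ∧ y.1 = (vis a, Rate.pas w)

open Classical in
/-- The visible names of the initial transitions of `T`. -/
noncomputable def names (T : Proc ν V) : Finset ν :=
  ((trans T).filterMap fun y => match y.1.1 with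
    | .vis a => some a
    | .tau => none).toFinset

open Classical in
theorem mem_names {T : Proc ν V} {a : ν} : a ∈ names T ↔ ∃ y ∈ trans T, y.1.1 = vis a := by
  unfold names
  rw [Multiset.mem_toFinset, Multiset.mem_filterMap]
  refine exists_congr fun y => and_congr_right fun _ => ?_
  rcases y with ⟨⟨_ | b, r⟩, Q⟩ <;> simp

open Classical in
/-- The share of the initial transition `y` of `T` among those named `a`. -/
noncomputable def share (T : Proc ν V) (a : ν) (y : Act ν × Proc ν V) : ℝ :=
  if y.1.1 = vis a then passiveWeight y.1.2 / weightOf (trans T) (vis a) else 0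

theorem Passive.weightOf_pos {T : Proc ν V} (hT : T.Passive) {a : ν} (ha : a ∈ names T) :
    0 < weightOf (trans T) (vis a) := by
  obtain ⟨⟨⟨b, r⟩, Q⟩, hy, hb⟩ := mem_names.mp ha
  obtain ⟨c, w, hw, he⟩ := hT _ hy
  dsimp only at hb he
  obtain ⟨rfl, rfl⟩ := Prod.mk.inj he
  rw [← hb]
  refine Proc.weightOf_pos (fun x hx => ?_) hy
  obtain ⟨_, _, hw, he⟩ := hT _ hx
  rw [he]
  exact hw

theorem Passive.sum_share {T : Proc ν V} (hT : T.Passive) {a : ν} (ha : a ∈ names T) :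
    ((trans T).map (share T a)).sum = 1 := by
  classical
  have h := hT.weightOf_pos ha
  have : ((trans T).map (share T a)).sum =
      weightOf (trans T) (vis a) * (weightOf (trans T) (vis a))⁻¹ := by
    nth_rw 1 [weightOf_eq]
    rw [← Multiset.sum_map_mul_right]
    congr 1
    refine Multiset.map_congr rfl fun y _ => ?_
    unfold share
    split_ifs <;> simp [div_eq_mul_inv]
  rw [this, mul_inv_cancel₀ h.ne']

theorem sum_map_filterMap_product {α β γ : Type*} (m : Multiset α) (n : Multiset β)
    (F : α × β → Option γ) (k : γ → ℝ) :
    (((m ×ˢ n).filterMap F).map k).sum =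
      (m.map fun x => (n.map fun y => (F (x, y)).elim 0 k).sum).sum := by
  have h1 : ∀ s : Multiset (α × β), ((s.filterMap F).map k).sum
      = (s.map fun z => (F z).elim 0 k).sum := by
    intro s
    induction s using Multiset.induction_on with
    | empty => simp
    | cons z s ih =>
      cases h : F z with
      | none => rw [Multiset.filterMap_cons_none _ _ h]; simp [ih, h]
      | some c => rw [Multiset.filterMap_cons_some _ _ _ h]; simp [ih, h]
  rw [h1]
  change ((m.bind fun x => n.map (Prod.mk x)).map _).sum = _
  rw [Multiset.map_bind, Multiset.sum_bind]
  simp only [Multiset.map_map, Function.comp_def]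

open Classical in
-- With synchronization on all visible names, `P` moves alone on `τ` only and `T` never moves alone.
-- An exponential move of `P` with rate `r` is split among the equally named branches of `T`, each
-- receiving `r` times its share.
theorem sum_trans_interaction {P T : Proc ν V} (hP : P.Timed) (hT : T.Passive)
    (H : Proc ν V → ℝ) :
    ((trans (interaction P T)).map fun x => expRate x.1.2 * H x.2).sum =
      ∑ a ∈ names T, ((expMoves P {vis a}).map fun x =>
        x.1 * ((trans T).map fun y => share T a y * H (interaction x.2 y.2)).sum).sum
      + ((expMoves P {tau}).map fun x => x.1 * H (interaction x.2 T)).sum := by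
  unfold interaction
  rw [trans, parTrans, Multiset.map_add, Multiset.map_add, Multiset.sum_add, Multiset.sum_add]
  have h2 : (trans T).filter (fun y => y.1.1 ∉ vis '' Set.univ) = 0 := by
    rw [Multiset.filter_eq_nil]
    intro y hy h
    obtain ⟨a, w, _, he⟩ := hT y hy
    exact h ⟨a, trivial, by rw [he]⟩
  have h1 : (((((trans P).filter (fun x => x.1.1 ∉ vis '' Set.univ)).map
      fun x => (x.1, par x.2 Set.univ T)).map fun x => expRate x.1.2 * H x.2).sum) =
      ((expMoves P {tau}).map fun x => x.1 * H (par x.2 Set.univ T)).sum := by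
    rw [sum_expMoves P {tau} fun Q => H (par Q Set.univ T), Multiset.map_map]
    induction trans P using Multiset.induction_on with
    | empty => simp
    | cons x m ih =>
      rcases x with ⟨⟨_ | a, r⟩, Q⟩
      · rw [Multiset.filter_cons_of_pos _ (by simp), Multiset.map_cons, Multiset.sum_cons, ih]
        simp
      · rw [Multiset.filter_cons_of_neg _ (by simp), ih]
        simp
  rw [h1, h2, Multiset.map_zero, Multiset.map_zero, Multiset.sum_zero, add_zero, add_comm]
  congr 1
  rw [sum_map_filterMap_product]
  have h3 : ∀ a, ((expMoves P {vis a}).map fun x => x.1 * ((trans T).map fun y =>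
      share T a y * H (par x.2 Set.univ y.2)).sum).sum = ((trans P).map fun x =>
        if x.1.1 ∈ ({vis a} : Set (ActName ν)) then expRate x.1.2 * ((trans T).map fun y =>
          share T a y * H (par x.2 Set.univ y.2)).sum else 0).sum := fun a =>
    sum_expMoves P {vis a} fun Q => ((trans T).map fun y =>
      share T a y * H (par Q Set.univ y.2)).sum
  simp only [h3]
  rw [← Multiset.sum_map_sum]
  congr 1
  refine Multiset.map_congr rfl ?_
  rintro ⟨⟨b, r⟩, Q⟩ hx
  obtain ⟨b', r, hr, he⟩ := hP.exists_rate hx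
  dsimp only at he
  obtain ⟨rfl, rfl⟩ := Prod.mk.inj he
  dsimp only
  rcases b with _ | c
  · simp
  -- A visible move named `c` contributes only to the summand `a = c`, and finds no partner if the
  -- test does not offer `c`.
  by_cases hc : c ∈ names T
  · rw [Finset.sum_eq_single c]
    · rw [if_pos (Set.mem_singleton _), ← Multiset.sum_map_mul_left]
      congr 1
      refine Multiset.map_congr rfl ?_
      rintro ⟨⟨d, s⟩, R⟩ hy
      obtain ⟨d', w, hw, he⟩ := hT _ hy
      dsimp only at he
      obtain ⟨rfl, rfl⟩ := Prod.mk.inj he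
      by_cases hcd : c = d'
      · subst hcd
        simp [share, syncRate, expRate, passiveWeight, mul_assoc]
      · simp [share, hcd, Ne.symm hcd]
    · intro a _ hne
      simp [Ne.symm hne]
    · exact fun h => absurd hc h
  · rw [Finset.sum_eq_zero]
    · refine Multiset.sum_eq_zero fun z hz => ?_
      obtain ⟨y, hy, rfl⟩ := Multiset.mem_map.mp hz
      rw [if_neg]
      · rfl
      · exact fun h => hc (mem_names.mpr ⟨y, hy, h.1.symm⟩)
    · intro a ha
      rw [if_neg]
      simp only [Set.mem_singleton_iff, vis.injEq]
      rintro rfl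
      exact hc ha

/-- The mean of the success probabilities after the initial transitions of `T` named `a`. -/
noncomputable def meanAfter (T : Proc ν V) (a : ν) (P : Proc ν V) (θ : List ℝ) : ℝ :=
  ((trans T).map fun y => share T a y * passProb P y.2 θ).sum

/-- The shares of each offered name add up to one, so the weights of the test redistribute the rates
of `P` without changing their total. -/
theorem rateT_interaction {P T : Proc ν V} (hP : P.Timed) (hT : T.Passive) :
    rateT (interaction P T) = rateO P (vis '' (names T : Set ν) ∪ {tau}) := by
  classical
  have h := sum_trans_interaction hP hT fun _ => 1
  simp only [mul_one] at h
  rw [rateT_eq, h, rateO_eq]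
  have h1 : ∀ A, ((expMoves P A).map fun x => x.1).sum = rateO P A := fun A => rfl
  have h2 : ∀ a ∈ names T, ((expMoves P {vis a}).map fun x =>
      x.1 * ((trans T).map fun y => share T a y).sum).sum = rateO P {vis a} := by
    intro a ha
    rw [show ((trans T).map fun y => share T a y).sum = 1 from hT.sum_share ha]
    simp [rateO]
  rw [Finset.sum_congr rfl h2, h1]
  simp only [rateO_eq]
  rw [← Multiset.sum_map_sum, ← Multiset.sum_map_add]
  congr 1
  refine Multiset.map_congr rfl ?_
  rintro ⟨⟨_ | b, r⟩, Q⟩ hx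
  · simp
  · by_cases hb : b ∈ names T <;> simp [hb]

/-- A successful configuration can only make moves of its left component, since `success` has no
transitions; its successor is then successful as well. -/
theorem successfulComp_interaction_cons {P T : Proc ν V} {x : Act ν × Proc ν V}
    (hx : x ∈ trans (interaction P T)) (c : Comp ν V) :
    SuccessfulComp (interaction P T) (x :: c) ↔ SuccessfulComp x.2 c := by
  constructor
  · rintro ⟨C', hC', P', rfl⟩
    rw [List.map_cons, List.mem_cons] at hC'
    rcases hC' with h | h
    · unfold interaction at h
      simp only [par.injEq, true_and] at h
      obtain ⟨rfl, rfl⟩ := h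
      unfold interaction at hx
      rw [trans, parTrans, show trans (success : Proc ν V) = 0 by rw [trans],
        Multiset.product_zero] at hx
      simp only [Multiset.filter_zero, Multiset.map_zero, Multiset.filterMap_zero, add_zero] at hx
      obtain ⟨y, _, rfl⟩ := Multiset.mem_map.mp hx
      exact ⟨_, List.mem_cons_self, _, rfl⟩
    · exact ⟨_, h, P', rfl⟩
  · rintro ⟨C', hC', h⟩
    exact ⟨C', List.mem_cons_of_mem _ hC', h⟩

theorem passProb_cons {P T : Proc ν V} (hP : P.Timed) (hT : T.Passive) (t : ℝ) (θ : List ℝ) :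
    passProb P T (t :: θ) =
      if 1 / rateO P (vis '' (names T : Set ν) ∪ {tau}) ≤ t then
        ∑ a ∈ names T, ((expMoves P {vis a}).map fun x =>
          x.1 / rateO P (vis '' (names T : Set ν) ∪ {tau}) * meanAfter T a x.2 θ).sum
        + ((expMoves P {tau}).map fun x =>
          x.1 / rateO P (vis '' (names T : Set ν) ∪ {tau}) * passProb x.2 T θ).sum
      else 0 := by
  rw [passProb_eq, successProb_cons fun x hx c => successfulComp_interaction_cons hx c,
    rateT_interaction hP hT]
  have h := sum_trans_interaction hP hT fun C =>
    successProb C θ / rateO P (vis '' (names T : Set ν) ∪ {tau})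
  simp only [mul_div_assoc', Multiset.sum_map_div, ← Finset.sum_div, ← add_div] at h
  simp only [div_mul_eq_mul_div, Multiset.sum_map_div, ← Finset.sum_div, ← add_div]
  rw [h]
  rfl

theorem passProb_eq_step {P T : Proc ν V} (hP : P.Timed) (hT : T.Passive) (hs : T ≠ success)
    (θ : List ℝ) : passProb P T θ = step (names T) (meanAfter T) P θ := by
  induction θ generalizing P with
  | nil =>
    -- The empty computation only visits the initial configuration, which is not successful as `T ≠
    -- success`; this matches the value `0` of `step` at `[]`.
    rw [passProb_eq, successProb, List.length_nil, comps, Multiset.filter_singleton, if_neg]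
    · simp [step]
    · rintro ⟨⟨C, hC, P', rfl⟩, _⟩
      simp [interaction] at hC
      exact hs hC.2.symm
  | cons t θ ih =>
    rw [passProb_cons hP hT, step]
    congr 3
    refine Multiset.map_congr rfl fun x hx => ?_
    rw [ih (hP.of_mem_expMoves hx)]

end Proc

end MPC

namespace MPC

open ActName

namespace Formula

open Proc

variable {ν : Type*} {V : Type*}

/-! ### Formulas as choices among visible names -/

theorem eval_dia {a : ν} {φ : Formula ν} {g : ν → Proc ν V → List ℝ → ℝ}
    (h : ∀ P : Proc ν V, P.Timed → ∀ θ, φ.eval P θ = g a P θ) {P : Proc ν V} (hP : P.Timed)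
    (θ : List ℝ) : (dia a φ).eval P θ = step {a} g P θ := by
  induction θ generalizing P with
  | nil => simp [eval, step]
  | cons t θ ih =>
    have h1 : ((expMoves P {vis a}).map fun x => x.1 /
        rateO P ({vis a} ∪ {tau}) * φ.eval x.2 θ) = (expMoves P {vis a}).map fun x => x.1 /
        rateO P ({vis a} ∪ {tau}) * g a x.2 θ :=
      Multiset.map_congr rfl fun x hx => by rw [h x.2 (hP.of_mem_expMoves hx)]
    have h2 : ((expMoves P {tau}).map fun x => x.1 /
        rateO P ({vis a} ∪ {tau}) * (dia a φ).eval x.2 θ) = (expMoves P {tau}).map fun x => x.1 /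
        rateO P ({vis a} ∪ {tau}) * step {a} g x.2 θ :=
      Multiset.map_congr rfl fun x hx => by rw [ih (hP.of_mem_expMoves hx)]
    simp only [eval, step, h1, h2, Finset.coe_singleton, Set.image_singleton,
      Finset.sum_singleton]
    generalize rateO P ({vis a} ∪ {tau}) = R
    -- `step` has no clause for a vanishing rate: division by zero gives `0`, so all its summands
    -- vanish, as `eval` prescribes.
    by_cases hR : R = 0
    · simp [hR]
    · rw [if_neg hR]

/-- The rates are positive, so nothing can cancel. -/
theorem rateO_eq_zero {P : Proc ν V} (hP : P.Timed) {A : Set (ActName ν)} (h : rateO P A = 0)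
    {a : ActName ν} (ha : a ∈ A) : expMoves P {a} = 0 := by
  rw [Multiset.eq_zero_iff_forall_notMem]
  intro x hx
  have hx' : x ∈ expMoves P A := by
    obtain ⟨b, rfl, hb⟩ := mem_expMoves.mp hx
    exact mem_expMoves.mpr ⟨b, ha, hb⟩
  have : x.1 ≤ rateO P A := by
    refine Multiset.single_le_sum ?_ _ (Multiset.mem_map_of_mem _ hx')
    intro y hy
    obtain ⟨z, hz, rfl⟩ := Multiset.mem_map.mp hy
    exact (hP.pos_of_mem_expMoves hz).le
  exact absurd (hP.pos_of_mem_expMoves hx) (by linarith)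

/-- This is why the disjunction clause is adjusted as it is. Without initial `τ`-moves the exit rate
is only that of the names in `A`; the shift of the time bound restores the test against `1 / R`, and
the prefactor renormalizes the branch probabilities to denominator `R`. -/
theorem step_noInitTau {P : Proc ν V} (hP : P.Timed) (A : Finset ν)
    (g : ν → Proc ν V → List ℝ → ℝ) (t R : ℝ) (θ : List ℝ) :
    rateO P (vis '' (A : Set ν)) / R *
        step A g (noInitTau P) ((t + (1 / rateO P (vis '' (A : Set ν)) - 1 / R)) :: θ) =
      if 1 / R ≤ t then
        ∑ a ∈ A, ((expMoves P {vis a}).map fun x => x.1 / R * g a x.2 θ).sum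
      else 0 := by
  have hA : tau ∉ vis '' (A : Set ν) := by simp
  rw [step, rateO_noInitTau P hA, expMoves_noInitTau_tau]
  by_cases h0 : rateO P (vis '' (A : Set ν)) = 0
  · have : ∑ a ∈ A, ((expMoves P {vis a}).map fun x => x.1 / R * g a x.2 θ).sum = 0 :=
      Finset.sum_eq_zero fun a ha => by
        rw [rateO_eq_zero hP h0 (Set.mem_image_of_mem _ ha), Multiset.map_zero, Multiset.sum_zero]
    simp [h0, this]
  · have hc : 1 / rateO P (vis '' (A : Set ν)) ≤ t + (1 / rateO P (vis '' (A : Set ν)) - 1 / R) ↔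
        1 / R ≤ t := by constructor <;> intro h <;> linarith
    simp only [hc]
    split_ifs
    · rw [Multiset.map_zero, Multiset.sum_zero, add_zero, Finset.mul_sum]
      refine Finset.sum_congr rfl fun a _ => ?_
      rw [expMoves_noInitTau P (by simp), ← Multiset.sum_map_mul_left]
      congr 1
      refine Multiset.map_congr rfl fun x _ => ?_
      field_simp
    · simp

open Classical in
theorem eval_disj {φ₁ φ₂ : Formula ν} {A₁ A₂ : Finset ν} {g : ν → Proc ν V → List ℝ → ℝ}
    (hA₁ : φ₁.init = vis '' (A₁ : Set ν)) (hA₂ : φ₂.init = vis '' (A₂ : Set ν))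
    (hA : Disjoint A₁ A₂)
    (h₁ : ∀ P : Proc ν V, P.Timed → ∀ θ, φ₁.eval P θ = step A₁ g P θ)
    (h₂ : ∀ P : Proc ν V, P.Timed → ∀ θ, φ₂.eval P θ = step A₂ g P θ)
    {P : Proc ν V} (hP : P.Timed) (θ : List ℝ) :
    (disj φ₁ φ₂).eval P θ = step (A₁ ∪ A₂) g P θ := by
  induction θ generalizing P with
  | nil => simp [eval, step]
  | cons t θ ih =>
    have hi : (disj φ₁ φ₂).init ∪ {tau} = vis '' ((A₁ ∪ A₂ : Finset ν) : Set ν) ∪ {tau} := by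
      rw [init, hA₁, hA₂, Finset.coe_union, Set.image_union]
    simp only [eval, step, hi, hA₁, hA₂]
    generalize rateO P (vis '' ((A₁ ∪ A₂ : Finset ν) : Set ν) ∪ {tau}) = R
    rw [h₁ _ hP.noInitTau, h₂ _ hP.noInitTau, step_noInitTau hP, step_noInitTau hP]
    have h3 : ((expMoves P {tau}).map fun x => x.1 / R * (disj φ₁ φ₂).eval x.2 θ) =
        (expMoves P {tau}).map fun x => x.1 / R * step (A₁ ∪ A₂) g x.2 θ :=
      Multiset.map_congr rfl fun x hx => by rw [ih (hP.of_mem_expMoves hx)]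
    -- Disjointness of the initial names lets the two disjuncts add up to one sum over the union,
    -- with no move counted twice.
    rw [h3, Finset.sum_union hA]
    by_cases hR : R = 0
    · simp [hR]
    · rw [if_neg hR]
      split_ifs <;> simp

/-- The formula is the iterated disjunction of the `dia a (ψ a)`; distinct names make it admissible,
and `A` is nonempty because there is no empty disjunction. -/
theorem exists_isProper_eval_eq_step {A : Finset ν} (hA : A.Nonempty) (ψ : ν → Formula ν)
    (hψ : ∀ a ∈ A, (ψ a).InML) :
    ∃ φ : Formula ν, φ.IsProper ∧ φ.init = vis '' (A : Set ν) ∧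
      ∀ P : Proc ν V, P.Timed → ∀ θ, φ.eval P θ = step A (fun a => (ψ a).eval) P θ := by
  classical
  induction hA using Finset.Nonempty.cons_induction with
  | singleton a =>
    exact ⟨dia a (ψ a), hψ a (by simp), by simp [init], fun P hP θ =>
      eval_dia (g := fun a => (ψ a).eval) (fun _ _ _ => rfl) hP θ⟩
  | cons a A ha hA ih =>
    obtain ⟨φ, hφ, hi, he⟩ := ih fun b hb => hψ b (by simp [hb])
    refine ⟨disj (dia a (ψ a)) φ, ⟨hψ a (by simp), hφ, ?_⟩, ?_, fun P hP θ => ?_⟩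
    · rw [hi, init]
      ext x
      simp only [Set.mem_inter_iff, Set.mem_singleton_iff, Set.mem_image, Set.mem_empty_iff_false,
        iff_false]
      rintro ⟨rfl, b, hb, hba⟩
      exact ha (vis.inj hba ▸ hb)
    · rw [init, init, hi, Finset.coe_cons, Set.image_insert_eq]
      rfl
    · rw [eval_disj (A₁ := {a}) (A₂ := A) (g := fun a => (ψ a).eval) (by simp [init]) hi
        (by simpa using ha) (fun P hP θ => eval_dia (fun _ _ _ => rfl) hP θ) he hP θ,
        Finset.cons_eq_insert, Finset.insert_eq]

/-- The test `success` offers no name, so only internal moves remain. It is not an instance of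
`step`, since the empty computation already succeeds and the value at `[]` is `1`. -/
theorem passProb_success {P : Proc ν V} (hP : P.Timed) (θ : List ℝ) :
    passProb P success θ = (tt : Formula ν).eval P θ := by
  have ht : Proc.trans (success : Proc ν V) = 0 := by rw [Proc.trans]
  have hT : (success : Proc ν V).Passive := by simp [Passive, ht]
  have hn : names (success : Proc ν V) = ∅ := by simp [names, ht]
  induction θ generalizing P with
  | nil =>
    rw [passProb_eq, successProb, List.length_nil, comps, Multiset.filter_singleton, if_pos]
    · simp [eval, prob]
    · exact ⟨⟨_, List.mem_cons_self, P, rfl⟩, le_rfl, by simp [avgTime]⟩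
  | cons t θ ih =>
    have h : ∀ R : ℝ, ((expMoves P {tau}).map fun x => x.1 / R * passProb x.2 success θ) =
        (expMoves P {tau}).map fun x => x.1 / R * (tt : Formula ν).eval x.2 θ := fun R =>
      Multiset.map_congr rfl fun x hx => by rw [ih (hP.of_mem_expMoves hx)]
    rw [passProb_cons hP hT, hn]
    simp only [eval, h, Finset.coe_empty, Set.image_empty, Set.empty_union, Finset.sum_empty,
      zero_add]
    by_cases hR : rateO P {tau} = 0
    · simp [hR]
    · rw [if_neg hR]

end Formula

namespace Proc

variable {ν : Type*} {V : Type*}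

/-! ### Tests -/

theorem IsTestSum.ne_success {T : Proc ν V} (hT : T.IsTestSum) : T ≠ success := by
  rintro rfl
  simp [IsTestSum] at hT

theorem IsTestSum.passive {T : Proc ν V} (hT : T.IsTestSum) : T.Passive := by
  induction T with
  | pre α T ih =>
    rcases α with ⟨_ | a, r | w⟩ <;> simp only [IsTestSum] at hT
    intro y hy
    rw [trans, Multiset.mem_singleton] at hy
    exact ⟨a, w, hT.1, by rw [hy]⟩
  | alt T₁ T₂ ih₁ ih₂ =>
    intro y hy
    rw [trans, Multiset.mem_add] at hy
    exact hy.elim (ih₁ hT.1 y) (ih₂ hT.2 y)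
  | _ => simp [IsTestSum] at hT

theorem IsTestSum.names_nonempty {T : Proc ν V} (hT : T.IsTestSum) : (names T).Nonempty := by
  induction T with
  | pre α T ih =>
    rcases α with ⟨_ | a, r | w⟩ <;> simp only [IsTestSum] at hT
    exact ⟨a, mem_names.mpr ⟨_, by rw [trans, Multiset.mem_singleton], rfl⟩⟩
  | alt T₁ T₂ ih₁ ih₂ =>
    obtain ⟨a, ha⟩ := ih₁ hT.1
    obtain ⟨y, hy, h⟩ := mem_names.mp ha
    exact ⟨a, mem_names.mpr ⟨y, by rw [trans, Multiset.mem_add]; exact Or.inl hy, h⟩⟩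
  | _ => simp [IsTestSum] at hT

open Classical in
theorem names_alt (T₁ T₂ : Proc ν V) : names (alt T₁ T₂) = names T₁ ∪ names T₂ := by
  simp [names, trans, Multiset.filterMap_add]

theorem names_pre (a : ν) (r : Rate) (T : Proc ν V) : names (pre (vis a, r) T) = {a} := by
  ext b
  simp [mem_names, trans, eq_comm]

end Proc

end MPC

namespace MPC

open ActName

namespace Proc

variable {ν : Type*} {V : Type*}

/-! ### Formulas as tests without repeated names in a choice. -/

theorem meanAfter_pre {a : ν} {w : ℝ} (hw : 0 < w) (T P : Proc ν V) (θ : List ℝ) :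
    meanAfter (pre (vis a, Rate.pas w) T) a P θ = passProb P T θ := by
  simp [meanAfter, trans, share, weightOf, passiveWeight, hw.ne']

/-- If `T₂` does not offer `a`, it contributes neither to the weight of `a` nor to the average. For
disjoint alternatives, each side thus keeps its continuations unchanged. -/
theorem meanAfter_eq_of_notMem {T₁ T₂ T : Proc ν V} (hT : trans T = trans T₁ + trans T₂) {a : ν}
    (ha : a ∉ names T₂) : meanAfter T a = meanAfter T₁ a := by
  classical
  have h0 : ∀ y ∈ trans T₂, y.1.1 ≠ vis a := fun y hy h => ha (mem_names.mpr ⟨y, hy, h⟩)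
  have hw : weightOf (trans T) (vis a) = weightOf (trans T₁) (vis a) := by
    rw [weightOf_eq, weightOf_eq, hT, Multiset.map_add, Multiset.sum_add, add_eq_left]
    refine Multiset.sum_eq_zero fun z hz => ?_
    obtain ⟨y, hy, rfl⟩ := Multiset.mem_map.mp hz
    rw [if_neg (h0 y hy)]
  funext P θ
  have hs : share T a = share T₁ a := by
    funext y
    simp only [share, hw]
  rw [meanAfter, meanAfter, hs, hT, Multiset.map_add, Multiset.sum_add, add_eq_left]
  refine Multiset.sum_eq_zero fun z hz => ?_
  obtain ⟨y, hy, rfl⟩ := Multiset.mem_map.mp hz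
  rw [share, if_neg (h0 y hy), zero_mul]

end Proc

namespace Formula

open Proc

variable {ν : Type*} (V : Type*)

/-- Diamonds become prefixes of weight `1` and disjunctions become sums. The `step` form and the set
of names belong to the induction statement because `eval_disj` glues two disjuncts only in that
form. -/
theorem IsProper.exists_isTestSum {φ : Formula ν} (hφ : φ.IsProper) :
    ∃ T : Proc ν V, T.IsTestSum ∧ φ.init = vis '' (names T : Set ν) ∧
      ∀ P : Proc ν V, P.Timed → ∀ θ, φ.eval P θ = step (names T) (meanAfter T) P θ := by
  classical
  induction φ with
  | tt => exact hφ.elim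
  | dia a φ ih =>
    obtain ⟨T, hT, h⟩ : ∃ T : Proc ν V, T.IsTest ∧
        ∀ P : Proc ν V, P.Timed → ∀ θ, φ.eval P θ = passProb P T θ := by
      rcases hφ with rfl | hφ
      · exact ⟨success, Or.inl rfl, fun P hP θ => (passProb_success hP θ).symm⟩
      · obtain ⟨T, hT, _, h⟩ := ih hφ
        exact ⟨T, Or.inr hT, fun P hP θ => by
          rw [h P hP, passProb_eq_step hP hT.passive hT.ne_success]⟩
    refine ⟨pre (vis a, Rate.pas 1) T, ⟨one_pos, hT⟩, ?_, fun P hP θ => ?_⟩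
    · simp [init, names_pre]
    · rw [names_pre]
      exact eval_dia (fun P hP θ => by rw [h P hP, meanAfter_pre one_pos]) hP θ
  | disj φ₁ φ₂ ih₁ ih₂ =>
    obtain ⟨T₁, hT₁, hi₁, h₁⟩ := ih₁ hφ.1
    obtain ⟨T₂, hT₂, hi₂, h₂⟩ := ih₂ hφ.2.1
    have hd : Disjoint (names T₁) (names T₂) := by
      rw [Finset.disjoint_left]
      intro a ha₁ ha₂
      have : vis a ∈ φ₁.init ∩ φ₂.init := by
        rw [hi₁, hi₂]
        exact ⟨Set.mem_image_of_mem _ ha₁, Set.mem_image_of_mem _ ha₂⟩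
      rw [hφ.2.2] at this
      exact this
    refine ⟨alt T₁ T₂, ⟨hT₁, hT₂⟩, ?_, fun P hP θ => ?_⟩
    · rw [names_alt, init, hi₁, hi₂, Finset.coe_union, Set.image_union]
    · rw [names_alt]
      refine eval_disj hi₁ hi₂ hd (fun P hP θ => ?_) (fun P hP θ => ?_) hP θ
      · rw [h₁ P hP]
        refine step_congr (fun a ha Q _ θ => ?_) hP θ
        rw [meanAfter_eq_of_notMem (T := alt T₁ T₂) (T₁ := T₁) (by rw [Proc.trans])
          (Finset.disjoint_left.mp hd ha)]
      · rw [h₂ P hP]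
        refine step_congr (fun a ha Q _ θ => ?_) hP θ
        rw [meanAfter_eq_of_notMem (T := alt T₁ T₂) (T₁ := T₂) (by rw [Proc.trans, add_comm])
          (Finset.disjoint_right.mp hd ha)]

theorem InML.exists_isTest {φ : Formula ν} (hφ : φ.InML) :
    ∃ T : Proc ν V, T.IsTest ∧ ∀ P : Proc ν V, P.Timed → ∀ θ, φ.eval P θ = passProb P T θ := by
  rcases hφ with rfl | hφ
  · exact ⟨success, Or.inl rfl, fun P hP θ => (passProb_success hP θ).symm⟩
  · obtain ⟨T, hT, _, h⟩ := hφ.exists_isTestSum V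
    exact ⟨T, Or.inr hT, fun P hP θ => by
      rw [h P hP, passProb_eq_step hP hT.passive hT.ne_success]⟩

end Formula

namespace Proc

variable {ν : Type*} {V : Type*}

/-! ### Tests as mixtures of formulas -/

variable (ν V) in
/-- The interpretations of the formulas of the modal language on the timed process terms. -/
def modalFunctionals : Set (Proc ν V → List ℝ → ℝ) :=
  {f | ∃ φ : Formula ν, φ.InML ∧ f = Set.indicator {P | P.Timed} φ.eval}

/-- `step` as a linear function of the family of continuations. -/
noncomputable def stepLinear (A : Finset ν) :
    (A → Proc ν V → List ℝ → ℝ) →ₗ[ℝ] Proc ν V → List ℝ → ℝ := by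
  classical
  exact
  { toFun := fun h => Set.indicator {P | P.Timed}
      (step A fun a => if ha : a ∈ A then h ⟨a, ha⟩ else 0)
    map_add' := fun h h' => by
      rw [← Set.indicator_add', ← step_add]
      congr 2
      funext a
      by_cases ha : a ∈ A <;> simp [ha]
    map_smul' := fun c h => by
      rw [RingHom.id_apply]
      refine Eq.trans ?_ (Set.indicator_const_smul _ c _)
      change _ = Set.indicator _ (c • step A _)
      rw [← step_smul]
      congr 2
      funext a
      by_cases ha : a ∈ A <;> simp [ha] }

/-- Cutting the continuations to zero outside timed terms does no harm, since timed terms only move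
to timed terms. -/
theorem stepLinear_eq {A : Finset ν} {h : A → Proc ν V → List ℝ → ℝ}
    {g : ν → Proc ν V → List ℝ → ℝ}
    (hg : ∀ a : A, h a = Set.indicator {P | P.Timed} (g a)) :
    stepLinear A h = Set.indicator {P | P.Timed} (step A g) := by
  refine Set.indicator_congr fun P hP => ?_
  funext θ
  refine step_congr (fun a ha Q hQ θ => ?_) hP θ
  rw [dif_pos ha, hg, Set.indicator_of_mem (show Q ∈ {P : Proc ν V | P.Timed} from hQ)]

/-- A family of points of the hull lies in the hull of the product, and a linear map carries hulls
to hulls. So it suffices that `step` of a family of formulas is again a formula. -/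
theorem indicator_step_mem_convexHull {A : Finset ν} (hA : A.Nonempty)
    {g : ν → Proc ν V → List ℝ → ℝ}
    (hg : ∀ a ∈ A, Set.indicator {P | P.Timed} (g a) ∈ convexHull ℝ (modalFunctionals ν V)) :
    Set.indicator {P | P.Timed} (step A g) ∈ convexHull ℝ (modalFunctionals ν V) := by
  have h1 : (fun a : A => Set.indicator {P | P.Timed} (g a)) ∈
      convexHull ℝ (Set.univ.pi fun _ : A => modalFunctionals ν V) :=
    mem_convexHull_pi fun a _ => hg a a.2
  have h2 := Set.mem_image_of_mem (stepLinear A) h1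
  rw [LinearMap.image_convexHull, stepLinear_eq fun a => rfl] at h2
  refine convexHull_mono ?_ h2
  rintro _ ⟨h, hh, rfl⟩
  choose ψ hψ hh using fun a : A => hh a trivial
  classical
  obtain ⟨φ, hφ, _, he⟩ := Formula.exists_isProper_eval_eq_step hA
    (fun a => if ha : a ∈ A then ψ ⟨a, ha⟩ else Formula.tt) fun a ha => by simpa [ha] using hψ _
  refine ⟨φ, Or.inr hφ, ?_⟩
  rw [stepLinear_eq (g := fun a => (if ha : a ∈ A then ψ ⟨a, ha⟩ else Formula.tt).eval)
    fun a => by rw [hh, dif_pos a.2]]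
  refine Set.indicator_congr fun P hP => ?_
  funext θ
  exact (he P hP θ).symm

theorem multiset_sum_smul_mem_of_convex {α E : Type*} [AddCommGroup E] [Module ℝ E] {s : Set E}
    (hs : Convex ℝ s) (m : Multiset α) (w : α → ℝ) (f : α → E) (hw : ∀ x ∈ m, 0 ≤ w x)
    (h1 : (m.map w).sum = 1) (hf : ∀ x ∈ m, f x ∈ s) :
    (m.map fun x => w x • f x).sum ∈ s := by
  classical
  -- Repeated elements are grouped, their multiplicity being absorbed into the coefficient.
  rw [Finset.sum_multiset_map_count] at h1 ⊢
  simp only [← Nat.cast_smul_eq_nsmul ℝ, smul_smul, smul_eq_mul] at h1 ⊢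
  exact hs.sum_mem
    (fun x hx => mul_nonneg (Nat.cast_nonneg _) (hw x (Multiset.mem_toFinset.mp hx))) h1
    fun x hx => hf x (Multiset.mem_toFinset.mp hx)

/-- For each offered name the shares are nonnegative with sum one, so the mean over the branches is
a convex combination of continuations, to which `step` is then applied. -/
theorem indicator_passProb_mem_convexHull {T : Proc ν V} (hT : T.IsTestSum)
    (h : ∀ y ∈ trans T, Set.indicator {P | P.Timed} (fun P => passProb P y.2) ∈
      convexHull ℝ (modalFunctionals ν V)) :
    Set.indicator {P | P.Timed} (fun P => passProb P T) ∈ convexHull ℝ (modalFunctionals ν V) := by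
  have h1 : Set.indicator {P | P.Timed} (fun P => passProb P T) =
      Set.indicator {P | P.Timed} (step (names T) (meanAfter T)) :=
    Set.indicator_congr fun P hP => funext fun θ =>
      passProb_eq_step hP hT.passive hT.ne_success θ
  rw [h1]
  refine indicator_step_mem_convexHull hT.names_nonempty fun a ha => ?_
  have h2 : Set.indicator {P | P.Timed} (meanAfter T a) = ((trans T).map fun y =>
      share T a y • Set.indicator {P : Proc ν V | P.Timed} (fun P => passProb P y.2)).sum := by
    funext P θ
    rw [Pi.multiset_sum_apply, Pi.multiset_sum_apply, Multiset.map_map, Multiset.map_map]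
    by_cases hP : P.Timed <;> simp [hP, meanAfter]
  rw [h2]
  refine multiset_sum_smul_mem_of_convex (convex_convexHull ℝ _) _ _ _ (fun y hy => ?_)
    (hT.passive.sum_share ha) h
  have := hT.passive.weightOf_pos ha
  obtain ⟨b, w, hw, he⟩ := hT.passive y hy
  unfold share
  rw [he]
  simp only [passiveWeight]
  split_ifs <;> positivity

theorem indicator_passProb_success_mem :
    Set.indicator {P | P.Timed} (fun P => passProb P success) ∈
      convexHull ℝ (modalFunctionals ν V) :=
  subset_convexHull ℝ _ ⟨Formula.tt, Or.inl rfl, Set.indicator_congr fun _ hP =>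
    funext fun θ => Formula.passProb_success hP θ⟩

/-- The induction concerns the continuations of `T` instead of `T` itself: when both summands of
`alt` offer the same name, the shares are recomputed over their union, so membership of the summands
alone would not suffice. -/
theorem IsTestSum.indicator_passProb_mem {T : Proc ν V} (hT : T.IsTestSum) :
    ∀ y ∈ trans T, Set.indicator {P | P.Timed} (fun P => passProb P y.2) ∈
      convexHull ℝ (modalFunctionals ν V) := by
  induction T with
  | pre α T ih =>
    rcases α with ⟨_ | a, r | w⟩ <;> simp only [IsTestSum] at hT
    intro y hy
    rw [trans, Multiset.mem_singleton] at hy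
    subst hy
    rcases hT.2 with rfl | hT
    · exact indicator_passProb_success_mem
    · exact indicator_passProb_mem_convexHull hT (ih hT)
  | alt T₁ T₂ ih₁ ih₂ =>
    intro y hy
    rw [trans, Multiset.mem_add] at hy
    exact hy.elim (ih₁ hT.1 y) (ih₂ hT.2 y)
  | _ => simp [IsTestSum] at hT

theorem IsTest.indicator_passProb_mem {T : Proc ν V} (hT : T.IsTest) :
    Set.indicator {P | P.Timed} (fun P => passProb P T) ∈
      convexHull ℝ (modalFunctionals ν V) := by
  rcases hT with rfl | hT
  · exact indicator_passProb_success_mem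
  · exact indicator_passProb_mem_convexHull hT hT.indicator_passProb_mem

end Proc

end MPC

/-! ### The modal characterization. -/

theorem theorem7p1 {ν : Type*} {V : Type*} (P₁ P₂ : MPC.Proc ν V)
    (h₁ : P₁.PerfClosed) (h₂ : P₂.PerfClosed) :
    MPC.Proc.MTEquiv P₁ P₂ ↔
      ∀ φ : MPC.Formula ν, φ.InML → ∀ θ : List ℝ, (∀ t ∈ θ, 0 < t) →
        φ.eval P₁ θ = φ.eval P₂ θ := by
  constructor
  · intro h φ hφ θ hθ
    obtain ⟨T, hT, he⟩ := hφ.exists_isTest V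
    rw [he P₁ h₁.timed, he P₂ h₂.timed]
    exact h T hT θ hθ
  · intro h T hT θ hθ
    -- With `θ` fixed, agreement at the two terms is a linear condition, so it passes from the
    -- formulas to their convex hull, which contains every test.
    have hc : Convex ℝ {f : MPC.Proc ν V → List ℝ → ℝ | f P₁ θ = f P₂ θ} := by
      intro f hf g hg a b _ _ _
      simp only [Set.mem_ofPred_eq, Pi.add_apply, Pi.smul_apply] at hf hg ⊢
      rw [hf, hg]
    have hsub : MPC.Proc.modalFunctionals ν V ⊆ {f | f P₁ θ = f P₂ θ} := by
      rintro _ ⟨φ, hφ, rfl⟩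
      simpa [h₁.timed, h₂.timed] using h φ hφ θ hθ
    simpa [h₁.timed, h₂.timed] using convexHull_min hsub hc hT.indicator_passProb_mem
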